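/- Let $\Gamma$ be a group acting by isometries on a geodesic metric space $X$ which is hyperbolic in the sense of Gromov, and let $\Gamma$ act on the Gromov boundary $\partial X$ by the induced action. Let $h \in \Gamma$ be loxodromic, that is, $k \mapsto h^k \cdot x$ is a quasi-isometric embedding $\mathbb{Z} \to X$ for some (equivalently every) $x \in X$. Put $\partial_\pm h = (\partial_- h, \partial_+ h) \in \partial X \times \partial X$, where $\partial_{+} h = \lim_{k \to +\infty} h^{k} \cdot x$ and $\partial_- h = \lim_{k \to +\infty} h^{-k} \cdot x$ are the attracting and repelling points of $h$, and let $\mathrm{Stab}(\partial_\pm h) \le \Gamma$ be the subgroup of elements fixing the ordered pair $\partial_\pm h$. Say that $h$ satisfies the individual WPD property if for every $x \in X$ and $R > 0$ there is an integer $M > 0$ such that every subset $Z \subset \Gamma$ with the following property is finite: (a) for each $g \in Z$, $d(x, g x) < R$ and $d(h^M x, g h^M x) < R$. Say that $h$ satisfies WWPD if $h$ is loxodromic and for every $x \in X$ and $R > 0$ there is an integer $M \ge 1$ such that every subset $Z \subset \Gamma$ that satisfies (a) and the following property is finite: (b) no two distinct elements of $Z$ lie in the same left coset of $\mathrm{Stab}(\partial_\pm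 h)$. Then $h$ satisfies the individual WPD property if and only if $h$ satisfies WWPD and the group $\mathrm{Stab}(\partial_\pm h)$ is virtually cyclic (has a cyclic subgroup of finite index). -/

import Mathlib

open Filter

universe u v

namespace HypAction

section Space

variable {X : Type v} [MetricSpace X]

/-- The Gromov product `(x | y)_o`. -/
noncomputable def gromovProduct (o x y : X) : ℝ :=
  (dist x o + dist y o - dist x y) / 2

variable (X) in
/-- Geodesic metric spaces: any two points are joined by an isometrically embedded segment. -/
class IsGeodesicSpace : Prop where
  exists_geodesic : ∀ x y : X, ∃ c : ℝ → X, c 0 = x ∧ c (dist x y) = y ∧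
    ∀ s ∈ Set.Icc 0 (dist x y), ∀ t ∈ Set.Icc 0 (dist x y), dist (c s) (c t) = |s - t|

variable (X) in
/-- Hyperbolicity in the sense of Gromov (the four-point condition). -/
class IsGromovHyperbolic : Prop where
  exists_delta : ∃ δ : ℝ, ∀ o x y z : X,
    min (gromovProduct o x y) (gromovProduct o y z) - δ ≤ gromovProduct o x z

/-- A sequence converges at infinity: `(s i | s j)_o → ∞` as `i, j → ∞`
(for every base point `o`, equivalently for one). -/
def ConvergesAtInfinity (s : ℕ → X) : Prop :=
  ∀ o : X, Tendsto (fun p : ℕ × ℕ => gromovProduct o (s p.1) (s p.2)) atTop atTop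

/-- Two sequences are asymptotic: `(s n | t n)_o → ∞`. -/
def Asymptotic (s t : ℕ → X) : Prop :=
  ∀ o : X, Tendsto (fun n : ℕ => gromovProduct o (s n) (t n)) atTop atTop

theorem gromovProduct_comm (o x y : X) : gromovProduct o x y = gromovProduct o y x := by
  unfold gromovProduct
  rw [dist_comm x y]
  ring

theorem ConvergesAtInfinity.asymptotic_self {s : ℕ → X} (hs : ConvergesAtInfinity s) :
    Asymptotic s s := fun o => by
  have h : Tendsto (fun n : ℕ => (n, n)) atTop (atTop : Filter (ℕ × ℕ)) := by
    rw [← prod_atTop_atTop_eq]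
    exact tendsto_id.prodMk tendsto_id
  exact (hs o).comp h

theorem Asymptotic.symm {s t : ℕ → X} (h : Asymptotic s t) : Asymptotic t s := fun o => by
  simpa only [gromovProduct_comm o] using h o

theorem Asymptotic.trans [IsGromovHyperbolic X] {s t w : ℕ → X} (h₁ : Asymptotic s t)
    (h₂ : Asymptotic t w) : Asymptotic s w := fun o => by
  obtain ⟨δ, hδ⟩ := IsGromovHyperbolic.exists_delta (X := X)
  rw [tendsto_atTop]
  intro b
  filter_upwards [(tendsto_atTop.1 (h₁ o)) (b + δ), (tendsto_atTop.1 (h₂ o)) (b + δ)]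
    with n hn₁ hn₂
  have h₃ := hδ o (s n) (t n) (w n)
  have h₄ := le_min hn₁ hn₂
  linarith

variable (X) in
/-- Sequences converging at infinity, up to being asymptotic. -/
instance boundarySetoid [IsGromovHyperbolic X] :
    Setoid {s : ℕ → X // ConvergesAtInfinity s} where
  r s t := Asymptotic s.1 t.1
  iseqv := ⟨fun s => s.2.asymptotic_self, fun h => h.symm, fun h₁ h₂ => h₁.trans h₂⟩

variable (X) in
/-- The Gromov boundary `∂X` (as a set). -/
def GromovBoundary [IsGromovHyperbolic X] : Type v := Quotient (boundarySetoid X)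

/-- The boundary point that is the limit of a sequence converging at infinity. -/
def GromovBoundary.mk [IsGromovHyperbolic X] (s : ℕ → X) (hs : ConvergesAtInfinity s) :
    GromovBoundary X := Quotient.mk (boundarySetoid X) ⟨s, hs⟩

end Space

section Action

variable {Γ : Type u} [Group Γ] {X : Type v} [MetricSpace X] [MulAction Γ X]
  [IsIsometricSMul Γ X]

theorem gromovProduct_smul (g : Γ) (o x y : X) :
    gromovProduct o (g • x) (g • y) = gromovProduct (g⁻¹ • o) x y := by
  have key : ∀ z : X, dist (g • z) o = dist z (g⁻¹ • o) := fun z => by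
    rw [← dist_smul g z (g⁻¹ • o), smul_inv_smul]
  unfold gromovProduct
  rw [key, key, dist_smul]

theorem ConvergesAtInfinity.smul (g : Γ) {s : ℕ → X} (hs : ConvergesAtInfinity s) :
    ConvergesAtInfinity (fun n => g • s n) := fun o => by
  simpa only [gromovProduct_smul] using hs (g⁻¹ • o)

theorem Asymptotic.smul (g : Γ) {s t : ℕ → X} (h : Asymptotic s t) :
    Asymptotic (fun n => g • s n) (fun n => g • t n) := fun o => by
  simpa only [gromovProduct_smul] using h (g⁻¹ • o)

/-- The extended action on the boundary, `g • lim s = lim (g • s)`. -/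
instance [IsGromovHyperbolic X] : MulAction Γ (GromovBoundary X) where
  smul g := Quotient.map (fun s => ⟨fun n => g • s.1 n, s.2.smul g⟩)
    (fun _ _ h => Asymptotic.smul g h)
  one_smul ξ := by
    induction ξ using Quotient.inductionOn with
    | h s => exact congrArg (Quotient.mk _) (Subtype.ext (funext fun n => one_smul Γ (s.1 n)))
  mul_smul g k ξ := by
    induction ξ using Quotient.inductionOn with
    | h s => exact congrArg (Quotient.mk _) (Subtype.ext (funext fun n => mul_smul g k (s.1 n)))

variable (X) in
/-- `h` is loxodromic: the orbit map `k ↦ h ^ k • x` is a quasi-isometric embedding of `ℤ`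
for some (equivalently every) `x`. -/
def IsLoxodromic (h : Γ) : Prop :=
  ∃ x : X, ∃ K ≥ (1 : ℝ), ∃ C ≥ (0 : ℝ), ∀ m n : ℤ,
    K⁻¹ * |(m : ℝ) - n| - C ≤ dist (h ^ m • x) (h ^ n • x) ∧
      dist (h ^ m • x) (h ^ n • x) ≤ K * |(m : ℝ) - n| + C

theorem IsLoxodromic.inv {h : Γ} (hh : IsLoxodromic X h) : IsLoxodromic X h⁻¹ := by
  obtain ⟨x, K, hK, C, hC, H⟩ := hh
  refine ⟨x, K, hK, C, hC, fun m n => ?_⟩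
  have h₁ := H (-m) (-n)
  have h₂ : |((-m : ℤ) : ℝ) - (-n : ℤ)| = |(m : ℝ) - n| := by
    push_cast
    rw [← abs_neg]
    congr 1
    ring
  rw [h₂] at h₁
  simpa only [inv_zpow'] using h₁

theorem dist_pow_smul (h : Γ) (x : X) (m n : ℕ) :
    dist (h ^ m • x) (h ^ (m + n) • x) = dist x (h ^ n • x) := by
  rw [pow_add, mul_smul, dist_smul]

theorem four_point {δ : ℝ} (hδ : ∀ o x y z : X,
    min (gromovProduct o x y) (gromovProduct o y z) - δ ≤ gromovProduct o x z) (o x y z : X) :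
    dist x z + dist y o ≤ max (dist x y + dist z o) (dist y z + dist x o) + 2 * δ := by
  have h := hδ o x y z
  unfold gromovProduct at h
  rcases min_choice ((dist x o + dist y o - dist x y) / 2)
    ((dist y o + dist z o - dist y z) / 2) with h' | h' <;> rw [h'] at h
  · have := le_max_left (dist x y + dist z o) (dist y z + dist x o)
    linarith
  · have := le_max_right (dist x y + dist z o) (dist y z + dist x o)
    linarith

/-- The orbit of an isometry with large enough displacement escapes without backtracking. -/
theorem orbit_growth {δ : ℝ} (hδ0 : 0 ≤ δ) (hδ : ∀ o x y z : X,
    min (gromovProduct o x y) (gromovProduct o y z) - δ ≤ gromovProduct o x z) (g : Γ) (x : X)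
    (hg : dist x (g • x) + (3 * δ + 1) ≤ dist x (g ^ 2 • x)) :
    ∃ c : ℝ, ∀ n m : ℕ, (min n m : ℕ) - c ≤ gromovProduct x (g ^ n • x) (g ^ m • x) := by
  set f : ℕ → ℝ := fun n => dist x (g ^ n • x) with hf
  have hd : ∀ m n : ℕ, dist (g ^ m • x) (g ^ (m + n) • x) = f n := fun m n =>
    dist_pow_smul g x m n
  have hf0 : f 0 = 0 := by simp [hf]
  have hg' : f 1 + (3 * δ + 1) ≤ f 2 := by simpa [hf] using hg
  have hf1 : 3 * δ + 1 ≤ f 1 := by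
    have h₁ : f 2 ≤ f 1 + f 1 := by
      have := dist_triangle x (g ^ 1 • x) (g ^ 2 • x)
      rw [hd 1 1] at this
      exact this
    linarith
  have step : ∀ j : ℕ, f j + (δ + 1) ≤ f (j + 1) := by
    intro j
    induction j with
    | zero => rw [hf0]; simpa using by linarith
    | succ j ih =>
      have h4 := four_point hδ (g ^ (j + 2) • x) x (g ^ 1 • x) (g ^ 2 • x)
      have e1 : dist (g ^ 1 • x) (g ^ (j + 2) • x) = f (j + 1) := by
        rw [← hd 1 (j + 1)]; congr 3; ring
      have e2 : dist (g ^ 2 • x) (g ^ (j + 2) • x) = f j := by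
        rw [← hd 2 j]; congr 3; ring
      have e3 : dist (g ^ 1 • x) (g ^ 2 • x) = f 1 := hd 1 1
      rw [e1, e2, e3] at h4
      change f 2 + f (j + 1) ≤ max (f 1 + f j) (f 1 + f (j + 2)) + 2 * δ at h4
      change f (j + 1) + (δ + 1) ≤ f (j + 2)
      rcases max_choice (f 1 + f j) (f 1 + f (j + 2)) with h' | h' <;> rw [h'] at h4 <;> linarith
  have lin : ∀ j : ℕ, (j : ℝ) ≤ f j := by
    intro j
    induction j with
    | zero => simp [hf0]
    | succ j ih => push_cast; linarith [step j]
  -- additivity up to a constant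
  set c : ℝ := f 1 + 2 * δ with hc
  have add : ∀ n m : ℕ, f n + f m - 2 * c ≤ f (n + m) := by
    intro n m
    have hc0 : 0 ≤ c := by linarith
    rcases n with _ | n
    · simp only [hf0, zero_add]; linarith
    rcases m with _ | m
    · simp only [hf0, add_zero]; linarith
    have a1 := hδ (g ^ (n + 1) • x) (g ^ n • x) x (g ^ (n + 1 + 1) • x)
    have a2 := hδ (g ^ (n + 1) • x) x (g ^ (n + 1 + (m + 1)) • x) (g ^ (n + 1 + 1) • x)
    have d1 : dist (g ^ n • x) (g ^ (n + 1) • x) = f 1 := hd n 1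
    have d2 : dist (g ^ (n + 1 + 1) • x) (g ^ (n + 1) • x) = f 1 := by
      rw [dist_comm]; exact hd (n + 1) 1
    have d3 : dist (g ^ n • x) (g ^ (n + 1 + 1) • x) = f 2 := hd n 2
    have d4 : dist (g ^ n • x) x = f n := dist_comm _ _
    have d5 : dist x (g ^ (n + 1) • x) = f (n + 1) := rfl
    have d6 : dist (g ^ (n + 1 + (m + 1)) • x) (g ^ (n + 1) • x) = f (m + 1) := by
      rw [dist_comm]; exact hd (n + 1) (m + 1)
    have d7 : dist (g ^ (n + 1 + (m + 1)) • x) (g ^ (n + 1 + 1) • x) = f m := by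
      rw [dist_comm, ← hd (n + 1 + 1) m]; congr 3; ring
    have d8 : dist x (g ^ (n + 1 + (m + 1)) • x) = f (n + 1 + (m + 1)) := rfl
    have s1 := step n
    have s2 := step m
    have s0 : 0 ≤ f 2 := dist_nonneg
    unfold gromovProduct at a1 a2
    rw [d1, d2, d3, d4, d5] at a1
    rw [d2, d5, d6, d7, d8] at a2
    rcases min_le_iff.1 (tsub_le_iff_right.1 a1) with b1 | b1
    · linarith
    rcases min_le_iff.1 (tsub_le_iff_right.1 a2) with b2 | b2
    · linarith
    · linarith
  have main : ∀ n k : ℕ, (n : ℝ) - c ≤ gromovProduct x (g ^ n • x) (g ^ (n + k) • x) := by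
    intro n k
    unfold gromovProduct
    rw [hd n k, dist_comm _ x, dist_comm _ x]
    change _ ≤ (f n + f (n + k) - f k) / 2
    linarith [add n k, lin n]
  refine ⟨c, fun n m => ?_⟩
  rcases le_total n m with hnm | hnm
  · obtain ⟨k, rfl⟩ := Nat.exists_eq_add_of_le hnm
    rw [min_eq_left hnm]
    exact main n k
  · obtain ⟨k, rfl⟩ := Nat.exists_eq_add_of_le hnm
    rw [min_eq_right hnm, gromovProduct_comm]
    exact main m k

theorem gromovProduct_sub_le (o x y x' y' : X) :
    gromovProduct o x y - (dist x x' + dist y y') ≤ gromovProduct o x' y' := by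
  unfold gromovProduct
  have h₁ := dist_triangle x x' o
  have h₂ := dist_triangle y y' o
  have h₃ := dist_triangle4 x' x y y'
  rw [dist_comm x' x] at h₃
  linarith

theorem gromovProduct_sub_le_base (o o' x y : X) :
    gromovProduct o x y - dist o o' ≤ gromovProduct o' x y := by
  unfold gromovProduct
  have h₁ := dist_triangle x o' o
  have h₂ := dist_triangle y o' o
  rw [dist_comm o' o] at h₁ h₂
  linarith

/-- Forward orbits of a loxodromic element converge at infinity. -/
theorem IsLoxodromic.convergesAtInfinity [IsGromovHyperbolic X] {h : Γ}
    (hh : IsLoxodromic X h) (y : X) : ConvergesAtInfinity (fun n : ℕ => h ^ n • y) := by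
  obtain ⟨δ₀, hδ₀⟩ := IsGromovHyperbolic.exists_delta (X := X)
  obtain ⟨δ, hδ0, hδ⟩ : ∃ δ : ℝ, 0 ≤ δ ∧ ∀ o x y z : X,
      min (gromovProduct o x y) (gromovProduct o y z) - δ ≤ gromovProduct o x z :=
    ⟨max δ₀ 0, le_max_right _ _, fun o x y z => by
      linarith [hδ₀ o x y z, le_max_left δ₀ 0]⟩
  obtain ⟨x, K, hK, C, hC, H⟩ := hh
  have hKpos : 0 < K⁻¹ := inv_pos.2 (by linarith)
  have low : ∀ n : ℕ, K⁻¹ * n - C ≤ dist x (h ^ n • x) := by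
    intro n
    have h₁ := (H 0 n).1
    simpa [abs_neg] using h₁
  -- a power of two at which the displacement nearly doubles
  obtain ⟨N, hN, hgap⟩ : ∃ N : ℕ, 0 < N ∧
      dist x (h ^ N • x) + (3 * δ + 1) ≤ dist x ((h ^ N) ^ 2 • x) := by
    by_contra hcon
    push Not at hcon
    have up : ∀ k : ℕ, dist x (h ^ (2 ^ k) • x) ≤ dist x (h • x) + k * (3 * δ + 1) := by
      intro k
      induction k with
      | zero => simp
      | succ k ih =>
        have h₁ := hcon (2 ^ k) (by positivity)
        rw [← pow_mul, ← pow_succ] at h₁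
        push_cast
        linarith
    have t : Tendsto (fun k : ℕ => (k : ℝ) / 2 ^ k) atTop (nhds 0) := by
      simpa using tendsto_pow_const_div_const_pow_of_one_lt 1 (one_lt_two (α := ℝ))
    have t2 : Tendsto (fun k : ℕ => (1 : ℝ) / 2 ^ k) atTop (nhds 0) := by
      simpa using tendsto_pow_const_div_const_pow_of_one_lt 0 (one_lt_two (α := ℝ))
    have t3 : Tendsto (fun k : ℕ => (dist x (h • x) + C) * ((1 : ℝ) / 2 ^ k) +
        (3 * δ + 1) * ((k : ℝ) / 2 ^ k)) atTop (nhds 0) := by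
      simpa using (t2.const_mul (dist x (h • x) + C)).add (t.const_mul (3 * δ + 1))
    obtain ⟨k, hk⟩ := (t3.eventually (gt_mem_nhds hKpos)).exists
    have h₁ := low (2 ^ k)
    have h₂ := up k
    push_cast at h₁
    have hp : (0 : ℝ) < 2 ^ k := by positivity
    have h₃ : (dist x (h • x) + C) * ((1 : ℝ) / 2 ^ k) + (3 * δ + 1) * ((k : ℝ) / 2 ^ k) =
        (dist x (h • x) + C + (3 * δ + 1) * k) / 2 ^ k := by
      field_simp
    rw [h₃, div_lt_iff₀ hp] at hk
    linarith
  obtain ⟨c, hc⟩ := orbit_growth hδ0 hδ (h ^ N) x hgap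
  -- compare the orbit of `y` with the orbit of `x` under `h ^ N`
  have near : ∀ r : ℕ, dist x (h ^ r • x) ≤ r * dist x (h • x) := by
    intro r
    induction r with
    | zero => simp
    | succ r ih =>
      have h₁ := dist_triangle x (h ^ r • x) (h ^ (r + 1) • x)
      rw [dist_pow_smul, pow_one] at h₁
      push_cast
      linarith
  set B : ℝ := N * dist x (h • x) + dist x y with hB
  have close : ∀ n : ℕ, dist ((h ^ N) ^ (n / N) • x) (h ^ n • y) ≤ B := by
    intro n
    have h₁ := dist_triangle ((h ^ N) ^ (n / N) • x) (h ^ n • x) (h ^ n • y)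
    have h₂ : dist ((h ^ N) ^ (n / N) • x) (h ^ n • x) ≤ N * dist x (h • x) := by
      conv_lhs => rw [← pow_mul, ← Nat.div_add_mod n N, Nat.mul_add_div hN,
        Nat.mod_div_self, add_zero, dist_pow_smul]
      refine (near _).trans ?_
      have : ((n % N : ℕ) : ℝ) ≤ N := by exact_mod_cast (Nat.mod_lt n hN).le
      exact mul_le_mul_of_nonneg_right this dist_nonneg
    rw [dist_smul] at h₁
    linarith
  intro o
  rw [tendsto_atTop]
  intro b
  obtain ⟨L, hL⟩ := exists_nat_ge (b + c + 2 * B + dist x o)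
  filter_upwards [eventually_ge_atTop ((L * N, L * N) : ℕ × ℕ)] with p hp
  have e1 : L ≤ p.1 / N := (Nat.le_div_iff_mul_le hN).2 hp.1
  have e2 : L ≤ p.2 / N := (Nat.le_div_iff_mul_le hN).2 hp.2
  have e3 : (L : ℝ) ≤ (min (p.1 / N) (p.2 / N) : ℕ) := by exact_mod_cast le_min e1 e2
  have h₁ := hc (p.1 / N) (p.2 / N)
  have h₂ := gromovProduct_sub_le x ((h ^ N) ^ (p.1 / N) • x) ((h ^ N) ^ (p.2 / N) • x)
    (h ^ p.1 • y) (h ^ p.2 • y)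
  have h₃ := gromovProduct_sub_le_base x o (h ^ p.1 • y) (h ^ p.2 • y)
  linarith [close p.1, close p.2]

/-- The attracting point `∂₊h = lim_{n → ∞} h ^ n • x`. -/
noncomputable def attractingPoint [IsGromovHyperbolic X] (h : Γ) (hh : IsLoxodromic X h) :
    GromovBoundary X :=
  GromovBoundary.mk (fun n : ℕ => h ^ n • hh.choose) (hh.convergesAtInfinity hh.choose)

/-- The repelling point `∂₋h = lim_{n → ∞} h ^ (-n) • x`. -/
noncomputable def repellingPoint [IsGromovHyperbolic X] (h : Γ) (hh : IsLoxodromic X h) :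
    GromovBoundary X :=
  attractingPoint h⁻¹ hh.inv

/-- The attracting point does not depend on the chosen `x`. -/
theorem attractingPoint_eq [IsGromovHyperbolic X] {h : Γ} (hh : IsLoxodromic X h) (y : X) :
    attractingPoint h hh =
      GromovBoundary.mk (fun n : ℕ => h ^ n • y) (hh.convergesAtInfinity y) := by
  refine Quotient.sound (s := boundarySetoid X) ?_
  intro o
  have t := (hh.convergesAtInfinity hh.choose).asymptotic_self o
  rw [tendsto_atTop] at t ⊢
  intro b
  filter_upwards [t (b + dist hh.choose y)] with n hn
  have h₁ := gromovProduct_sub_le o (h ^ n • hh.choose) (h ^ n • hh.choose)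
    (h ^ n • hh.choose) (h ^ n • y)
  rw [dist_self, dist_smul, zero_add] at h₁
  linarith

/-- `Stab(∂±h)`: the elements of `Γ` fixing the ordered pair `(∂₋h, ∂₊h)`. -/
noncomputable def endpointStabilizer [IsGromovHyperbolic X] (h : Γ) (hh : IsLoxodromic X h) :
    Subgroup Γ :=
  MulAction.stabilizer Γ
    ((repellingPoint h hh, attractingPoint h hh) : GromovBoundary X × GromovBoundary X)

variable (X) in
/-- The individual WPD property of `h`. -/
def IsWPD (h : Γ) : Prop :=
  ∀ x : X, ∀ R : ℝ, 0 < R → ∃ M : ℕ, 0 < M ∧ ∀ Z : Set Γ,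
    (∀ g ∈ Z, dist x (g • x) < R ∧ dist (h ^ M • x) (g • h ^ M • x) < R) → Z.Finite

variable (X) in
/-- `h` is WWPD: it is loxodromic and equivariantly acylindrical, i.e. it satisfies the WPD
condition for those sets `Z` whose elements lie in distinct left cosets of `Stab(∂±h)`. -/
def IsWWPD [IsGromovHyperbolic X] (h : Γ) : Prop :=
  ∃ hh : IsLoxodromic X h, ∀ x : X, ∀ R : ℝ, 0 < R → ∃ M : ℕ, 1 ≤ M ∧ ∀ Z : Set Γ,
    (∀ g ∈ Z, dist x (g • x) < R ∧ dist (h ^ M • x) (g • h ^ M • x) < R) →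
    (∀ g ∈ Z, ∀ k ∈ Z, g ≠ k → (g : Γ ⧸ endpointStabilizer h hh) ≠ k) → Z.Finite

end Action

/-- A group is virtually cyclic if it has a cyclic subgroup of finite index. -/
def IsVirtuallyCyclic (G : Type u) [Group G] : Prop :=
  ∃ N : Subgroup G, IsCyclic N ∧ N.FiniteIndex

end HypAction

namespace HypAction

section Metric

variable {X : Type v} [MetricSpace X]

theorem gromovProduct_nonneg (o x y : X) : 0 ≤ gromovProduct o x y := by
  unfold gromovProduct
  have := dist_triangle x o y
  rw [dist_comm o y] at this
  linarith

theorem gromovProduct_self_left (o y : X) : gromovProduct o o y = 0 := by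
  unfold gromovProduct
  rw [dist_self, dist_comm y o]
  ring

theorem gromovProduct_self_right (o y : X) : gromovProduct o y o = 0 := by
  rw [gromovProduct_comm, gromovProduct_self_left]

theorem exists_nonneg_delta (X : Type v) [MetricSpace X] [IsGromovHyperbolic X] :
    ∃ δ : ℝ, 0 ≤ δ ∧ ∀ o x y z : X,
      min (gromovProduct o x y) (gromovProduct o y z) - δ ≤ gromovProduct o x z := by
  obtain ⟨δ₀, hδ₀⟩ := IsGromovHyperbolic.exists_delta (X := X)
  exact ⟨max δ₀ 0, le_max_right _ _, fun o x y z => by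
    linarith [hδ₀ o x y z, le_max_left δ₀ 0]⟩

/-- A point between the endpoints of a coarse path without backtracking is close to the path. -/
theorem exists_dist_path_le {δ c c' L : ℝ} (hδ0 : 0 ≤ δ) (hc : 0 ≤ c) (hL : 0 ≤ L)
    (hδ : ∀ o x y z : X,
      min (gromovProduct o x y) (gromovProduct o y z) - δ ≤ gromovProduct o x z)
    (q : ℕ → X) (n : ℕ) (hq : ∀ j, dist (q j) (q (j + 1)) ≤ L)
    (hbt : ∀ j ≤ n, gromovProduct (q j) (q 0) (q n) ≤ c)
    (p : X) (hp : gromovProduct p (q 0) (q n) ≤ c') :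
    ∃ j ≤ n, dist p (q j) ≤ 3 * c + 2 * δ + L + c' := by
  obtain ⟨j, hj, h₁, h₂⟩ : ∃ j ≤ n, gromovProduct (q j) (q 0) p ≤ c + δ ∧
      gromovProduct (q j) p (q n) ≤ c + δ + L := by
    by_contra! hcon
    have all : ∀ j ≤ n, gromovProduct (q j) (q 0) p ≤ c + δ := by
      intro j
      induction j with
      | zero => intro _; rw [gromovProduct_self_left]; linarith
      | succ j ih =>
        intro hj
        have h₁ := hcon j (by omega) (ih (by omega))
        have h₂ := gromovProduct_sub_le_base (q j) (q (j + 1)) p (q n)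
        have h₃ := hδ (q (j + 1)) (q 0) p (q n)
        have h₄ := hbt (j + 1) hj
        have h₅ := hq j
        rcases min_le_iff.1 (tsub_le_iff_right.1 h₃) with h | h <;> linarith
    have h₁ := hcon n le_rfl (all n le_rfl)
    rw [gromovProduct_self_right] at h₁
    linarith
  refine ⟨j, hj, ?_⟩
  have h₃ := dist_triangle (q 0) (q j) (q n)
  have h₄ := hbt j hj
  unfold gromovProduct at h₁ h₂ hp h₄
  rw [dist_comm (q n) (q j), dist_comm (q n) p] at *
  rw [dist_comm p (q n)] at *
  linarith [dist_comm (q n) (q j), dist_comm (q n) p]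

theorem GromovBoundary.mk_eq_mk_iff [IsGromovHyperbolic X] {s t : ℕ → X} (hs : ConvergesAtInfinity s)
    (ht : ConvergesAtInfinity t) :
    GromovBoundary.mk s hs = GromovBoundary.mk t ht ↔ Asymptotic s t := by
  unfold GromovBoundary.mk
  exact Quotient.eq (r := boundarySetoid X)

/-- A group element with an orbit of at least linear growth has a power at which the displacement
nearly doubles. -/
theorem exists_pow_gap {Γ : Type u} [Group Γ] [MulAction Γ X] (h : Γ) (x : X)
    {κ C : ℝ} (hκ : 0 < κ)
    (low : ∀ n : ℕ, κ * n - C ≤ dist x (h ^ n • x)) (b : ℝ) :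
    ∃ N : ℕ, 0 < N ∧ dist x (h ^ N • x) + b ≤ dist x ((h ^ N) ^ 2 • x) := by
  by_contra! hcon
  have up : ∀ k : ℕ, dist x (h ^ (2 ^ k) • x) ≤ dist x (h • x) + k * b := by
    intro k
    induction k with
    | zero => simp
    | succ k ih =>
      have h₁ := hcon (2 ^ k) (by positivity)
      rw [← pow_mul, ← pow_succ] at h₁
      push_cast
      linarith
  have t : Tendsto (fun k : ℕ => (k : ℝ) / 2 ^ k) atTop (nhds 0) := by
    simpa using tendsto_pow_const_div_const_pow_of_one_lt 1 (one_lt_two (α := ℝ))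
  have t2 : Tendsto (fun k : ℕ => (1 : ℝ) / 2 ^ k) atTop (nhds 0) := by
    simpa using tendsto_pow_const_div_const_pow_of_one_lt 0 (one_lt_two (α := ℝ))
  have t3 : Tendsto (fun k : ℕ => (dist x (h • x) + C) * ((1 : ℝ) / 2 ^ k) +
      b * ((k : ℝ) / 2 ^ k)) atTop (nhds 0) := by
    simpa using (t2.const_mul (dist x (h • x) + C)).add (t.const_mul b)
  obtain ⟨k, hk⟩ := (t3.eventually (gt_mem_nhds hκ)).exists
  have h₁ := low (2 ^ k)
  have h₂ := up k
  push_cast at h₁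
  have hp : (0 : ℝ) < 2 ^ k := by positivity
  have h₃ : (dist x (h • x) + C) * ((1 : ℝ) / 2 ^ k) + b * ((k : ℝ) / 2 ^ k) =
      (dist x (h • x) + C + b * k) / 2 ^ k := by
    field_simp
  rw [h₃, div_lt_iff₀ hp] at hk
  linarith

end Metric

section Orbit

variable {Γ : Type u} [Group Γ] {X : Type v} [MetricSpace X] [MulAction Γ X]
  [IsIsometricSMul Γ X]

/-- The displacement of powers is coarsely superadditive. -/
theorem coarse_superadditive {δ : ℝ} (hδ0 : 0 ≤ δ) (hδ : ∀ o x y z : X,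
    min (gromovProduct o x y) (gromovProduct o y z) - δ ≤ gromovProduct o x z) (g : Γ) (x : X)
    (hg : dist x (g • x) + (3 * δ + 1) ≤ dist x (g ^ 2 • x)) :
    ∃ c : ℝ, 0 ≤ c ∧ ∀ n m : ℕ,
      dist x (g ^ n • x) + dist x (g ^ m • x) - 2 * c ≤ dist x (g ^ (n + m) • x) := by
  set f : ℕ → ℝ := fun n => dist x (g ^ n • x) with hf
  have hd : ∀ m n : ℕ, dist (g ^ m • x) (g ^ (m + n) • x) = f n := fun m n =>
    dist_pow_smul g x m n
  have hf0 : f 0 = 0 := by simp [hf]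
  have hg' : f 1 + (3 * δ + 1) ≤ f 2 := by simpa [hf] using hg
  have hf1 : 3 * δ + 1 ≤ f 1 := by
    have h₁ := dist_triangle x (g ^ 1 • x) (g ^ 2 • x)
    rw [hd 1 1] at h₁
    change f 2 ≤ f 1 + f 1 at h₁
    linarith
  have step : ∀ j : ℕ, f j + (δ + 1) ≤ f (j + 1) := by
    intro j
    induction j with
    | zero => rw [hf0]; simpa using by linarith
    | succ j ih =>
      have h4 := four_point hδ (g ^ (j + 2) • x) x (g ^ 1 • x) (g ^ 2 • x)
      have e1 : dist (g ^ 1 • x) (g ^ (j + 2) • x) = f (j + 1) := by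
        rw [← hd 1 (j + 1)]; congr 3; ring
      have e2 : dist (g ^ 2 • x) (g ^ (j + 2) • x) = f j := by
        rw [← hd 2 j]; congr 3; ring
      have e3 : dist (g ^ 1 • x) (g ^ 2 • x) = f 1 := hd 1 1
      rw [e1, e2, e3] at h4
      change f 2 + f (j + 1) ≤ max (f 1 + f j) (f 1 + f (j + 2)) + 2 * δ at h4
      change f (j + 1) + (δ + 1) ≤ f (j + 2)
      rcases max_choice (f 1 + f j) (f 1 + f (j + 2)) with h' | h' <;> rw [h'] at h4 <;> linarith
  have hc0 : 0 ≤ f 1 + 2 * δ := by linarith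
  refine ⟨f 1 + 2 * δ, hc0, fun n m => ?_⟩
  change f n + f m - 2 * (f 1 + 2 * δ) ≤ f (n + m)
  rcases n with _ | n
  · simp only [hf0, zero_add]; linarith
  rcases m with _ | m
  · simp only [hf0, add_zero]; linarith
  have a1 := hδ (g ^ (n + 1) • x) (g ^ n • x) x (g ^ (n + 1 + 1) • x)
  have a2 := hδ (g ^ (n + 1) • x) x (g ^ (n + 1 + (m + 1)) • x) (g ^ (n + 1 + 1) • x)
  have d1 : dist (g ^ n • x) (g ^ (n + 1) • x) = f 1 := hd n 1
  have d2 : dist (g ^ (n + 1 + 1) • x) (g ^ (n + 1) • x) = f 1 := by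
    rw [dist_comm]; exact hd (n + 1) 1
  have d3 : dist (g ^ n • x) (g ^ (n + 1 + 1) • x) = f 2 := hd n 2
  have d4 : dist (g ^ n • x) x = f n := dist_comm _ _
  have d5 : dist x (g ^ (n + 1) • x) = f (n + 1) := rfl
  have d6 : dist (g ^ (n + 1 + (m + 1)) • x) (g ^ (n + 1) • x) = f (m + 1) := by
    rw [dist_comm]; exact hd (n + 1) (m + 1)
  have d7 : dist (g ^ (n + 1 + (m + 1)) • x) (g ^ (n + 1 + 1) • x) = f m := by
    rw [dist_comm, ← hd (n + 1 + 1) m]; congr 3; ring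
  have d8 : dist x (g ^ (n + 1 + (m + 1)) • x) = f (n + 1 + (m + 1)) := rfl
  have s1 := step n
  have s2 := step m
  have s0 : 0 ≤ f 2 := dist_nonneg
  unfold gromovProduct at a1 a2
  rw [d1, d2, d3, d4, d5] at a1
  rw [d2, d5, d6, d7, d8] at a2
  rcases min_le_iff.1 (tsub_le_iff_right.1 a1) with b1 | b1
  · linarith
  rcases min_le_iff.1 (tsub_le_iff_right.1 a2) with b2 | b2 <;> linarith

theorem dist_smul_pow_le (h : Γ) (x : X) (r : ℕ) :
    dist x (h ^ r • x) ≤ r * dist x (h • x) := by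
  induction r with
  | zero => simp
  | succ r ih =>
    have h₁ := dist_triangle x (h ^ r • x) (h ^ (r + 1) • x)
    rw [dist_pow_smul, pow_one] at h₁
    push_cast
    linarith

/-- An element coarsely fixing the ends of a coarse axis moves each point of the axis
a bounded distance from the axis. -/
theorem exists_dist_zpow_le {δ c : ℝ} (hδ0 : 0 ≤ δ) (hc : 0 ≤ c) (hδ : ∀ o x y z : X,
    min (gromovProduct o x y) (gromovProduct o y z) - δ ≤ gromovProduct o x z)
    {g : Γ} {x : X} (hadd : ∀ n m : ℕ,
      dist x (g ^ n • x) + dist x (g ^ m • x) - 2 * c ≤ dist x (g ^ (n + m) • x))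
    {s : Γ} (hp : Asymptotic (fun n : ℕ => g ^ n • x) (fun n : ℕ => s • g ^ n • x))
    (hm : Asymptotic (fun n : ℕ => g⁻¹ ^ n • x) (fun n : ℕ => s • g⁻¹ ^ n • x)) :
    ∃ k : ℤ, dist (s • x) (g ^ k • x) ≤ 4 * c + 4 * δ + dist x (g • x) := by
  have between : ∀ n m : ℕ, gromovProduct x (g⁻¹ ^ n • x) (g ^ m • x) ≤ c := by
    intro n m
    have e1 : dist (g⁻¹ ^ n • x) x = dist x (g ^ n • x) := by
      rw [← dist_smul (g ^ n) (g⁻¹ ^ n • x) x, smul_smul, inv_pow, mul_inv_cancel, one_smul]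
    have e2 : dist (g⁻¹ ^ n • x) (g ^ m • x) = dist x (g ^ (n + m) • x) := by
      rw [← dist_smul (g ^ n) (g⁻¹ ^ n • x), smul_smul, smul_smul, inv_pow, mul_inv_cancel,
        one_smul, pow_add]
    unfold gromovProduct
    rw [e1, e2, dist_comm _ x]
    linarith [hadd n m]
  obtain ⟨n, hn₁, hn₂⟩ := (((tendsto_atTop.1 (hp (s • x))) (c + 2 * δ + 1)).and
    ((tendsto_atTop.1 (hm (s • x))) (c + 2 * δ + 1))).exists
  have hb : gromovProduct (s • x) (g⁻¹ ^ n • x) (g ^ n • x) ≤ c + 2 * δ := by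
    by_contra! hcon
    have h₁ := hδ (s • x) (g⁻¹ ^ n • x) (g ^ n • x) (s • g ^ n • x)
    have h₂ := hδ (s • x) (s • g⁻¹ ^ n • x) (g⁻¹ ^ n • x) (s • g ^ n • x)
    rw [gromovProduct_comm _ (s • g⁻¹ ^ n • x), gromovProduct_smul, inv_smul_smul] at h₂
    have h₃ := between n n
    rcases min_le_iff.1 (tsub_le_iff_right.1 h₁) with h | h <;>
    rcases min_le_iff.1 (tsub_le_iff_right.1 h₂) with h' | h' <;> linarith
  set q : ℕ → X := fun j => g ^ ((j : ℤ) - n) • x with hq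
  have q0 : q 0 = g⁻¹ ^ n • x := by simp [hq]
  have q2 : q (2 * n) = g ^ n • x := by
    have : ((2 * n : ℕ) : ℤ) - n = n := by push_cast; ring
    simp only [hq, this, zpow_natCast]
  have hstep : ∀ j, dist (q j) (q (j + 1)) ≤ dist x (g • x) := by
    intro j
    have : ((j + 1 : ℕ) : ℤ) - n = (j : ℤ) - n + 1 := by push_cast; ring
    simp only [hq, this, zpow_add_one, mul_smul, dist_smul, le_refl]
  have hbt : ∀ j ≤ 2 * n, gromovProduct (q j) (q 0) (q (2 * n)) ≤ c := by
    intro j hj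
    have e1 : q 0 = g ^ ((j : ℤ) - n) • g⁻¹ ^ j • x := by
      simp only [hq, smul_smul]
      rw [inv_pow, ← zpow_natCast g j, ← zpow_neg, ← zpow_add]
      congr 2
      push_cast
      ring
    have e2 : q (2 * n) = g ^ ((j : ℤ) - n) • g ^ (2 * n - j) • x := by
      simp only [hq, smul_smul, ← zpow_natCast, ← zpow_add]
      congr 2
      push_cast [Nat.cast_sub hj]
      ring
    rw [e1, e2, gromovProduct_smul]
    simp only [hq, inv_smul_smul]
    exact between _ _
  obtain ⟨j, -, hj⟩ := exists_dist_path_le hδ0 hc dist_nonneg hδ q (2 * n) hstep hbt (s • x)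
    (c' := c + 2 * δ) (by rw [q0, q2]; exact hb)
  exact ⟨(j : ℤ) - n, hj.trans (by linarith)⟩

/-- An element coarsely fixing the forward end of a coarse axis, and moving its origin little,
moves all points of the forward ray little. -/
theorem dist_smul_pow_smul_le {δ c D : ℝ} (hδ : ∀ o x y z : X,
    min (gromovProduct o x y) (gromovProduct o y z) - δ ≤ gromovProduct o x z)
    {g : Γ} {x : X} (hδ0 : 0 ≤ δ) (hadd : ∀ n m : ℕ,
      dist x (g ^ n • x) + dist x (g ^ m • x) - 2 * c ≤ dist x (g ^ (n + m) • x))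
    {s : Γ} (hp : Asymptotic (fun n : ℕ => g ^ n • x) (fun n : ℕ => s • g ^ n • x))
    (hs : dist x (s • x) ≤ D) (m : ℕ) :
    dist (g ^ m • x) (s • g ^ m • x) ≤ 2 * c + 4 * δ + 3 * D := by
  have along : ∀ k, dist x (g ^ m • x) - c ≤ gromovProduct x (g ^ m • x) (g ^ (m + k) • x) := by
    intro k
    unfold gromovProduct
    rw [dist_pow_smul, dist_comm _ x, dist_comm _ x]
    linarith [hadd m k]
  obtain ⟨n, hn₁, hn₂⟩ := (((tendsto_atTop.1 (hp x)) (dist x (g ^ m • x) - c - D)).and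
    (eventually_ge_atTop m)).exists
  obtain ⟨k, rfl⟩ := Nat.exists_eq_add_of_le hn₂
  have h₁ := along k
  have h₂ : dist x (g ^ m • x) - c - D ≤
      gromovProduct x (s • g ^ (m + k) • x) (s • g ^ m • x) := by
    have h₃ := gromovProduct_sub_le_base (s • x) x (s • g ^ (m + k) • x) (s • g ^ m • x)
    rw [gromovProduct_smul, inv_smul_smul, gromovProduct_comm, dist_comm (s • x)] at h₃
    linarith
  have h₄ := hδ x (g ^ m • x) (g ^ (m + k) • x) (s • g ^ (m + k) • x)
  have h₅ := hδ x (g ^ m • x) (s • g ^ (m + k) • x) (s • g ^ m • x)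
  have h₆ : dist x (g ^ m • x) - c - D - 2 * δ ≤
      gromovProduct x (g ^ m • x) (s • g ^ m • x) := by
    have hD : 0 ≤ D := dist_nonneg.trans hs
    rcases min_le_iff.1 (tsub_le_iff_right.1 h₄) with h | h <;>
    rcases min_le_iff.1 (tsub_le_iff_right.1 h₅) with h' | h' <;> linarith
  have h₇ := dist_triangle (s • g ^ m • x) (s • x) x
  rw [dist_smul, dist_comm (s • x) x] at h₇
  unfold gromovProduct at h₆
  rw [dist_comm (g ^ m • x) x] at h₆ h₇
  linarith

theorem asymptotic_smul_of_commute {s g : Γ} (hsg : Commute s g) {x : X}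
    (hg : ConvergesAtInfinity (fun n : ℕ => g ^ n • x)) :
    Asymptotic (fun n : ℕ => g ^ n • x) (fun n : ℕ => s • g ^ n • x) := by
  intro o
  have t := hg.asymptotic_self o
  rw [tendsto_atTop] at t ⊢
  intro b
  filter_upwards [t (b + dist x (s • x))] with n hn
  have h₁ := gromovProduct_sub_le o (g ^ n • x) (g ^ n • x) (g ^ n • x) (s • g ^ n • x)
  rw [dist_self, smul_smul, (hsg.pow_right n).eq, mul_smul, dist_smul] at h₁
  rw [smul_smul, (hsg.pow_right n).eq, mul_smul]
  linarith

/-- Bounded displacement singles out finitely many powers of a loxodromic element. -/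
theorem IsLoxodromic.finite_zpow {h : Γ} (hh : IsLoxodromic X h) (y z : X) (r : ℝ) :
    {k : ℤ | dist y (h ^ k • z) ≤ r}.Finite := by
  obtain ⟨x, K, hK, C, hC, H⟩ := hh
  have hKpos : 0 < K := by linarith
  obtain ⟨L, hL⟩ := exists_nat_ge (K * (dist x y + r + dist z x + C))
  refine (Set.finite_Icc (-(L : ℤ)) L).subset fun k hk => ?_
  have h₁ := (H k 0).1
  have h₂ := dist_triangle4 x y (h ^ k • z) (h ^ k • x)
  rw [dist_smul] at h₂
  rw [zpow_zero, one_smul, dist_comm _ x] at h₁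
  have hk' : dist y (h ^ k • z) ≤ r := hk
  have h₃ : K⁻¹ * |(k : ℝ)| ≤ dist x y + r + dist z x + C := by
    have : |(k : ℝ) - (0 : ℤ)| = |(k : ℝ)| := by simp
    rw [this] at h₁
    linarith
  rw [inv_mul_le_iff₀ hKpos] at h₃
  have h₄ : |(k : ℝ)| ≤ L := h₃.trans hL
  rw [Set.mem_Icc, ← abs_le]
  exact_mod_cast h₄

end Orbit

section Stabilizer

variable {Γ : Type u} [Group Γ] {X : Type v} [MetricSpace X] [IsGromovHyperbolic X]
  [MulAction Γ X] [IsIsometricSMul Γ X]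

theorem GromovBoundary.smul_mk (g : Γ) {s : ℕ → X} (hs : ConvergesAtInfinity s) :
    g • GromovBoundary.mk s hs = GromovBoundary.mk (fun n => g • s n) (hs.smul g) :=
  rfl

theorem smul_attractingPoint_eq_iff {h : Γ} (hh : IsLoxodromic X h) (s : Γ) (x : X) :
    s • attractingPoint h hh = attractingPoint h hh ↔
      Asymptotic (fun n : ℕ => h ^ n • x) (fun n : ℕ => s • h ^ n • x) := by
  rw [attractingPoint_eq hh x, GromovBoundary.smul_mk, GromovBoundary.mk_eq_mk_iff]
  exact ⟨Asymptotic.symm, Asymptotic.symm⟩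

theorem mem_endpointStabilizer_iff {h : Γ} (hh : IsLoxodromic X h) (s : Γ) (x : X) :
    s ∈ endpointStabilizer h hh ↔
      Asymptotic (fun n : ℕ => h⁻¹ ^ n • x) (fun n : ℕ => s • h⁻¹ ^ n • x) ∧
      Asymptotic (fun n : ℕ => h ^ n • x) (fun n : ℕ => s • h ^ n • x) := by
  unfold endpointStabilizer
  rw [MulAction.mem_stabilizer_iff, Prod.smul_mk, Prod.mk.injEq]
  exact and_congr (smul_attractingPoint_eq_iff hh.inv s x) (smul_attractingPoint_eq_iff hh s x)

theorem zpow_mem_endpointStabilizer {h : Γ} (hh : IsLoxodromic X h) (k : ℤ) :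
    h ^ k ∈ endpointStabilizer h hh := by
  have x : X := hh.choose
  refine Subgroup.zpow_mem _ ((mem_endpointStabilizer_iff hh h x).2 ⟨?_, ?_⟩) k
  · exact asymptotic_smul_of_commute (Commute.refl h).inv_right (hh.inv.convergesAtInfinity x)
  · exact asymptotic_smul_of_commute (Commute.refl h) (hh.convergesAtInfinity x)

/-- Modulo powers of `h`, the elements of `Stab(∂±h)` move the forward orbit of some point
by a uniformly bounded amount. -/
theorem exists_uniform_displacement {h : Γ} (hh : IsLoxodromic X h) :
    ∃ x : X, ∃ R : ℝ, 0 < R ∧ ∀ s ∈ endpointStabilizer h hh, ∃ k : ℤ, ∀ m : ℕ,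
      dist (h ^ m • x) ((h ^ k * s) • h ^ m • x) < R := by
  obtain ⟨δ, hδ0, hδ⟩ := exists_nonneg_delta X
  obtain ⟨x, K, hK, C, hC, H⟩ := id hh
  have hκ : 0 < K⁻¹ := inv_pos.2 (by linarith)
  obtain ⟨N, hN, hgap⟩ := exists_pow_gap h x hκ
    (fun n => by simpa [abs_neg] using (H 0 n).1) (3 * δ + 1)
  obtain ⟨c, hc, hadd⟩ := coarse_superadditive hδ0 hδ (h ^ N) x hgap
  have sub : ∀ {a s : Γ}, Asymptotic (fun n : ℕ => a ^ n • x) (fun n : ℕ => s • a ^ n • x) →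
      Asymptotic (fun n : ℕ => (a ^ N) ^ n • x) (fun n : ℕ => s • (a ^ N) ^ n • x) := by
    intro a s hs o
    simpa only [← pow_mul, Function.comp_def, id] using
      (hs o).comp (tendsto_id.const_mul_atTop' hN)
  set D : ℝ := 4 * c + 4 * δ + dist x (h ^ N • x) with hD
  have hD0 : 0 ≤ D := by positivity
  set B : ℝ := N * dist x (h • x) with hB
  have hB0 : 0 ≤ B := by positivity
  refine ⟨x, 2 * c + 4 * δ + 3 * D + 2 * B + 1, by positivity, fun s hs => ?_⟩
  obtain ⟨hs₁, hs₂⟩ := (mem_endpointStabilizer_iff hh s x).1 hs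
  obtain ⟨k, hk⟩ := exists_dist_zpow_le hδ0 hc hδ hadd (sub hs₂)
    (by simpa only [inv_pow] using sub hs₁)
  have e : (h ^ N) ^ (-k) = h ^ (N * -k : ℤ) := by rw [zpow_mul, zpow_natCast]
  refine ⟨N * -k, fun m => ?_⟩
  have hs' := (endpointStabilizer h hh).mul_mem (zpow_mem_endpointStabilizer hh (N * -k)) hs
  set s' := h ^ (N * -k : ℤ) * s with hs'_def
  have hx : dist x (s' • x) ≤ D := by
    rw [hs'_def, ← e, mul_smul, zpow_neg, ← dist_smul ((h ^ N) ^ k), smul_inv_smul, dist_comm]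
    exact hk
  have h₁ := dist_smul_pow_smul_le hδ hδ0 hadd
    (sub ((mem_endpointStabilizer_iff hh s' x).1 hs').2) hx (m / N)
  have h₂ : dist ((h ^ N) ^ (m / N) • x) (h ^ m • x) ≤ B := by
    conv_lhs => rw [← pow_mul, ← Nat.div_add_mod m N, Nat.mul_add_div hN,
      Nat.mod_div_self, add_zero, dist_pow_smul]
    refine (dist_smul_pow_le h x _).trans ?_
    have : ((m % N : ℕ) : ℝ) ≤ N := by exact_mod_cast (Nat.mod_lt m hN).le
    exact mul_le_mul_of_nonneg_right this dist_nonneg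
  have h₃ := dist_triangle4 (h ^ m • x) ((h ^ N) ^ (m / N) • x) (s' • (h ^ N) ^ (m / N) • x)
    (s' • h ^ m • x)
  rw [dist_smul, dist_comm (h ^ m • x) ((h ^ N) ^ (m / N) • x)] at h₃
  linarith

end Stabilizer

section Groups

variable {G : Type u} [Group G]

/-- An infinite-order element of a virtually cyclic group generates a subgroup of finite index. -/
theorem IsVirtuallyCyclic.exists_finite_transversal (hG : IsVirtuallyCyclic G) {h : G}
    (hh : ∀ n : ℕ, 0 < n → h ^ n ≠ 1) :
    ∃ T : Set G, T.Finite ∧ ∀ s : G, ∃ k : ℤ, ∃ t ∈ T, s = h ^ k * t := by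
  obtain ⟨N, hN, hfin⟩ := hG
  obtain ⟨a, ha⟩ := hN.exists_generator
  obtain ⟨m, hm, hmN⟩ : ∃ m : ℕ, 0 < m ∧ h ^ m ∈ N := by
    obtain ⟨m, hm, -, hmN⟩ := Subgroup.exists_pow_mem_of_index_ne_zero hfin.index_ne_zero h
    exact ⟨m, hm, hmN⟩
  obtain ⟨j, hj⟩ := Subgroup.mem_zpowers_iff.1 (ha ⟨h ^ m, hmN⟩)
  have hj' : (a : G) ^ j = h ^ m := by simpa using congrArg Subtype.val hj
  have hj0 : j ≠ 0 := by
    rintro rfl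
    exact hh m hm (by simpa using hj'.symm)
  have : Finite (G ⧸ N) := inferInstance
  refine ⟨(fun p : ℤ × (G ⧸ N) => (a : G) ^ p.1 * (p.2.out)⁻¹) ''
    (Set.Icc 0 |j| ×ˢ Set.univ), ((Set.finite_Icc _ _).prod Set.finite_univ).image _, fun s => ?_⟩
  obtain ⟨⟨n, hnN⟩, hn⟩ := QuotientGroup.mk_out_eq_mul N s⁻¹
  obtain ⟨i, hi⟩ := Subgroup.mem_zpowers_iff.1 (ha ⟨n, hnN⟩)
  have hi' : (a : G) ^ i = n := by simpa using congrArg Subtype.val hi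
  refine ⟨m * (i / j), _, ⟨(i % j, (s⁻¹ : G)), ⟨⟨Int.emod_nonneg _ hj0,
    (Int.emod_lt_abs _ hj0).le⟩, Set.mem_univ _⟩, rfl⟩, ?_⟩
  simp only [hn, mul_inv_rev, inv_inv]
  rw [zpow_mul, zpow_natCast, ← hj', ← zpow_mul, ← mul_assoc, ← zpow_add, Int.mul_ediv_add_emod,
    ← mul_assoc, hi', mul_inv_cancel, one_mul]

end Groups

section Main

variable {Γ : Type u} [Group Γ] {X : Type v} [MetricSpace X] [IsGromovHyperbolic X]
  [MulAction Γ X] [IsIsometricSMul Γ X]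

theorem IsWPD.isWWPD {h : Γ} (hw : IsWPD X h) (hh : IsLoxodromic X h) : IsWWPD X h :=
  ⟨hh, fun x R hR => by
    obtain ⟨M, hM, H⟩ := hw x R hR
    exact ⟨M, hM, fun Z hZ _ => H Z hZ⟩⟩

theorem IsWPD.isVirtuallyCyclic {h : Γ} (hw : IsWPD X h) (hh : IsLoxodromic X h) :
    IsVirtuallyCyclic (endpointStabilizer h hh) := by
  obtain ⟨x, R, hR, H⟩ := exists_uniform_displacement hh
  obtain ⟨M, -, hM⟩ := hw x R hR
  have hfin := hM {g | dist x (g • x) < R ∧ dist (h ^ M • x) (g • h ^ M • x) < R} fun _ hg => hg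
  have hmem : h ∈ endpointStabilizer h hh := by simpa using zpow_mem_endpointStabilizer hh 1
  set η : endpointStabilizer h hh := ⟨h, hmem⟩ with hη
  have hfin' := hfin.preimage (Subtype.val_injective (p := (· ∈ endpointStabilizer h hh))).injOn
  refine ⟨Subgroup.zpowers η, inferInstance, ?_⟩
  have : Finite (endpointStabilizer h hh ⧸ Subgroup.zpowers η) := by
    refine Set.finite_univ_iff.1 ((hfin'.image
      fun g => ((g⁻¹ : endpointStabilizer h hh) : _ ⧸ Subgroup.zpowers η)).subset ?_)
    intro q _
    induction q using QuotientGroup.induction_on with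
    | H s =>
      obtain ⟨k, hk⟩ := H (s⁻¹ : endpointStabilizer h hh) (s⁻¹).2
      refine ⟨η ^ k * s⁻¹, ⟨by simpa using hk 0, by simpa using hk M⟩, ?_⟩
      rw [QuotientGroup.eq]
      simp [Subgroup.zpow_mem_zpowers]
  exact Subgroup.finiteIndex_of_finite_quotient

/-- If `Stab(∂±h)` is virtually cyclic, then it acts properly on orbits. -/
theorem finite_endpointStabilizer_dist_lt {h : Γ} (hh : IsLoxodromic X h)
    (hv : IsVirtuallyCyclic (endpointStabilizer h hh)) (x : X) (r : ℝ) :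
    {s ∈ (endpointStabilizer h hh : Set Γ) | dist x (s • x) ≤ r}.Finite := by
  have hmem : h ∈ endpointStabilizer h hh := by simpa using zpow_mem_endpointStabilizer hh 1
  obtain ⟨T, hT, hT'⟩ := hv.exists_finite_transversal (h := ⟨h, hmem⟩) (fun n hn h1 => by
    have h1' : h ^ n = 1 := by simpa using congrArg Subtype.val h1
    have hinf := hh.finite_zpow x x 0
    refine Set.infinite_of_injective_forall_mem (f := fun i : ℤ => (n : ℤ) * i)
      (fun i j hij => ?_) (fun i => ?_) hinf
    · exact mul_left_cancel₀ (by exact_mod_cast hn.ne') hij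
    · simp [zpow_mul, h1'])
  refine (hT.biUnion fun t _ =>
    (hh.finite_zpow x ((t : Γ) • x) r).image fun k => h ^ k * (t : Γ)).subset ?_
  rintro s ⟨hs, hsr⟩
  obtain ⟨k, t, ht, hk⟩ := hT' ⟨s, hs⟩
  have hk' : s = h ^ k * (t : Γ) := by simpa using congrArg Subtype.val hk
  refine Set.mem_biUnion ht ⟨k, ?_, hk'.symm⟩
  rw [hk', mul_smul] at hsr
  exact hsr

theorem IsWWPD.isWPD {h : Γ} (hw : IsWWPD X h) (hh : IsLoxodromic X h)
    (hv : IsVirtuallyCyclic (endpointStabilizer h hh)) : IsWPD X h := by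
  obtain ⟨_, hw⟩ := hw
  intro x R hR
  obtain ⟨M, hM, H⟩ := hw x R hR
  refine ⟨M, hM, fun Z hZ => ?_⟩
  obtain ⟨Z', hZ', hbij⟩ := (Set.surjOn_image
    (fun g : Γ => (g : Γ ⧸ endpointStabilizer h hh)) Z).exists_bijOn_subset
  have hfin : Z'.Finite := H Z' (fun g hg => hZ g (hZ' hg))
    fun g hg k hk hgk hq => hgk (hbij.injOn hg hk hq)
  refine (hfin.biUnion fun g _ =>
    (finite_endpointStabilizer_dist_lt hh hv x (2 * R)).image fun s => g * s).subset ?_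
  intro k hk
  obtain ⟨g, hg, hgk⟩ := hbij.surjOn (Set.mem_image_of_mem _ hk)
  refine Set.mem_biUnion hg ⟨g⁻¹ * k, ⟨QuotientGroup.eq.1 hgk, ?_⟩, mul_inv_cancel_left g k⟩
  have h₁ := (hZ g (hZ' hg)).1
  have h₂ := (hZ k hk).1
  have h₃ := dist_triangle (g • x) x (k • x)
  rw [mul_smul, ← dist_smul g, smul_inv_smul]
  rw [dist_comm (g • x) x] at h₃
  linarith

end Main

end HypAction

theorem mainTheorem6 {Γ : Type u} [Group Γ] {X : Type v} [MetricSpace X]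
    [HypAction.IsGeodesicSpace X] [HypAction.IsGromovHyperbolic X]
    [MulAction Γ X] [IsIsometricSMul Γ X] (h : Γ) (hh : HypAction.IsLoxodromic X h) :
    HypAction.IsWPD X h ↔
      HypAction.IsWWPD X h ∧
        HypAction.IsVirtuallyCyclic (HypAction.endpointStabilizer h hh) :=
  ⟨fun hw => ⟨hw.isWWPD hh, hw.isVirtuallyCyclic hh⟩, fun hw => hw.1.isWPD hh hw.2⟩
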